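/- Let $\mathcal L\in\mathbb R^{n\times n}$ be the Laplacian of a connected undirected graph on $n$ vertices, let $d\in\mathbb R$ and $0<\underline K\le\overline K$, and let $\phi:\mathbb R^n\to\mathbb R$ be continuously differentiable and convex, with compact sublevel sets and with a Lipschitz gradient. Put $\mathcal F_c=\{q\in\mathbb R^n:\mathbf 1^Tq=c\}$ and let $\mathcal Q^*$ be the set of minimizers of $\phi$ over $\mathcal F_d$. Consider the constrained differential inclusion (HiHBM) for $x=(q,p)\in\mathbb R^{2n}$: $$\dot x\in F(x)=\Big\{\big(p,\,-k\,p-\mathcal L\nabla\phi(q)\big):\ k\in\kappa(x)\Big\},\qquad x\in C=\mathcal F_d\times\mathcal F_0,$$ where $\kappa(x)=\{\overline K\}$ if $\langle\mathcal L\nabla\phi(q),p\rangle>0$, $\kappa(x)=\{\underline K\}$ if $\langle\mathcal L\nabla\phi(q),p\rangle<0$, and $\kappa(x)=[\underline K,\overline K]$ if $\langle\mathcal L\nabla\phi(q),p\rangle=0$. A solution is a locally absolutely continuous function $x:I\to C$, on an interval $I=[0,T]$, $[0,T)$ or $[0,\infty)$, with $\dot x(t)\in F(x(t))$ for almost every $t\in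 I$; it is complete if $I=[0,\infty)$. Then the set $\mathcal A=\mathcal Q^*\times\{0\}$ is globally asymptotically stable for HiHBM. That is, with $|x|_{\mathcal A}$ the Euclidean distance from $x$ to $\mathcal A$: $\mathcal A$ is nonempty and compact; for every $\varepsilon>0$ there is $\delta>0$ such that every solution with $|x(0)|_{\mathcal A}\le\delta$ satisfies $|x(t)|_{\mathcal A}\le\varepsilon$ for all $t\in I$; and every solution, from any initial condition, is bounded and, if complete, satisfies $\lim_{t\to\infty}|x(t)|_{\mathcal A}=0$. -/

import Mathlib

open Set Filter Topology MeasureTheory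
open scoped Gradient

/-! Constrained differential inclusions `x' ∈ F x`, `x ∈ C`, and their stability notions. -/

namespace DiffIncl

variable {X : Type*} [NormedAddCommGroup X] [NormedSpace ℝ X]

/-- `x`, restricted to the time domain `I`, is a solution of the constrained differential inclusion
`x' ∈ F x`, `x ∈ C`. The domain `I` is any interval of the form `[0, T]` (with `T ≥ 0`), `[0, T)`
(with `T > 0`) or `[0, ∞)`; `x` is locally absolutely continuous on `I`, stays in `C`, and
satisfies the inclusion for almost every `t ∈ I`. Values of `x` outside `I` are irrelevant.
Solutions are neither required to be maximal nor assumed to be unique. -/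
structure IsSolution (F : X → Set X) (C : Set X) (I : Set ℝ) (x : ℝ → X) : Prop where
  zero_mem : (0 : ℝ) ∈ I
  nonneg : ∀ t ∈ I, 0 ≤ t
  ordConnected : I.OrdConnected
  absCont : ∀ a ∈ I, ∀ b ∈ I, AbsolutelyContinuousOnInterval x a b
  mem : ∀ t ∈ I, x t ∈ C
  deriv_mem : ∀ᵐ t ∂(volume.restrict I), ∃ v ∈ F (x t), HasDerivAt x v t

/-- The solution `x` on `I` is bounded and, if complete (that is, if its time domain is unbounded),
its distance to `A` tends to `0`. -/
def BoundedAndConverges (I : Set ℝ) (x : ℝ → X) (A : Set X) : Prop :=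
  Bornology.IsBounded (x '' I) ∧
    (¬ BddAbove I → Tendsto (fun t => Metric.infDist (x t) A) atTop (𝓝 0))

/-- Stability of `A`. -/
def IsStable (F : X → Set X) (C A : Set X) : Prop :=
  ∀ ε > 0, ∃ δ > 0, ∀ (I : Set ℝ) (x : ℝ → X), IsSolution F C I x →
    Metric.infDist (x 0) A ≤ δ → ∀ t ∈ I, Metric.infDist (x t) A ≤ ε

/-- Local attractivity of `A`. -/
def IsAttractive (F : X → Set X) (C A : Set X) : Prop :=
  ∃ δ > 0, ∀ (I : Set ℝ) (x : ℝ → X), IsSolution F C I x →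
    Metric.infDist (x 0) A ≤ δ → BoundedAndConverges I x A

/-- The basin of attraction of `A`: the initial conditions from which each solution is bounded and,
if complete, converges to `A`. -/
def basin (F : X → Set X) (C A : Set X) : Set X :=
  {x₀ | ∀ (I : Set ℝ) (x : ℝ → X), IsSolution F C I x → x 0 = x₀ → BoundedAndConverges I x A}

/-- Global asymptotic stability of the nonempty compact set `A`: it is stable and attractive, and
its basin of attraction is the whole state space. -/
structure IsGAS (F : X → Set X) (C A : Set X) : Prop where
  nonempty : A.Nonempty
  isCompact : IsCompact A
  stable : IsStable F C A
  attractive : IsAttractive F C A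
  basin_eq : basin F C A = univ

end DiffIncl

/-! The Laplacian-gradient hybrid-inspired heavy ball method. -/

namespace HiHBM

/-- The state space `ℝⁿ × ℝⁿ = ℝ²ⁿ` of pairs `(q, p)`, with its Euclidean norm. -/
abbrev State (n : ℕ) : Type :=
  WithLp 2 (EuclideanSpace ℝ (Fin n) × EuclideanSpace ℝ (Fin n))

/-- The feasible set `{q | 1ᵀ q = d}`. -/
def feasible (n : ℕ) (d : ℝ) : Set (EuclideanSpace ℝ (Fin n)) :=
  {q | ∑ i, q i = d}

/-- The set of minimizers of `φ` over the feasible set. -/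
def minimizers {n : ℕ} (φ : EuclideanSpace ℝ (Fin n) → ℝ) (d : ℝ) :
    Set (EuclideanSpace ℝ (Fin n)) :=
  {q | q ∈ feasible n d ∧ ∀ w ∈ feasible n d, φ q ≤ φ w}

/-- The constraint set `{(q, p) | 1ᵀ q = d, 1ᵀ p = 0}`. -/
def flowSet (n : ℕ) (d : ℝ) : Set (State n) :=
  {x | x.fst ∈ feasible n d ∧ x.snd ∈ feasible n 0}

/-- The vector `𝓛 ∇φ(q)`, where `𝓛` is the Laplacian of the graph `G`. -/
noncomputable def lapGrad {n : ℕ} (G : SimpleGraph (Fin n)) [DecidableRel G.Adj]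
    (φ : EuclideanSpace ℝ (Fin n) → ℝ) (q : EuclideanSpace ℝ (Fin n)) :
    EuclideanSpace ℝ (Fin n) :=
  Matrix.toEuclideanLin (G.lapMatrix ℝ) (∇ φ q)

/-- The set-valued damping coefficient, as a function of the number `s = ⟪𝓛 ∇φ(q), p⟫`: it is
`{Kmax}` for `s > 0`, `{Kmin}` for `s < 0`, and `[Kmin, Kmax]` for `s = 0`. -/
noncomputable def damping (Kmin Kmax s : ℝ) : Set ℝ :=
  if 0 < s then {Kmax} else if s < 0 then {Kmin} else Icc Kmin Kmax

/-- The set-valued flow map `F(q, p) = {(p, -k p - 𝓛 ∇φ(q)) | k ∈ κ(q, p)}`. -/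
noncomputable def flowMap {n : ℕ} (G : SimpleGraph (Fin n)) [DecidableRel G.Adj]
    (φ : EuclideanSpace ℝ (Fin n) → ℝ) (Kmin Kmax : ℝ) (x : State n) : Set (State n) :=
  {v | ∃ k ∈ damping Kmin Kmax (inner ℝ (lapGrad G φ x.fst) x.snd),
    v = WithLp.toLp 2 (x.snd, -(k • x.snd) - lapGrad G φ x.fst)}

/-- The set `Q* × {0}`. -/
def target {n : ℕ} (φ : EuclideanSpace ℝ (Fin n) → ℝ) (d : ℝ) : Set (State n) :=
  {x | x.fst ∈ minimizers φ d ∧ x.snd = 0}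

end HiHBM

/-! Absolutely continuous curves. -/

/-! The Lyapunov function is `V(q, p) = φ(q) + ⟪M p, p⟫ / 2`, where `M` is the inverse of `𝓛 + 𝟏𝟏ᵀ`
(`exists_lap_inverse`). For zero-sum `p`, `⟪M p, 𝓛 w⟫ = ⟪p, w⟫`, so the force and the drift of `φ`
cancel and `V' = -k ⟪M p, p⟫ ≤ -Kmin c ‖p‖²` (`energy_decay`). About the damping, only `Kmin ≤ k ≤
Kmax` is needed.

On the flow set, `V` has compact sublevel sets and its minimizers are exactly the target.
Monotonicity of `V` therefore gives boundedness and stability.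

Convergence is proved by estimates on short time windows, without an invariance principle. Since `V`
converges and the speed is bounded, a momentum that stayed large would dissipate too much energy, so
`p → 0` (`tendsto_norm_snd`). A force that stayed large would then move `p` too far over a window,
so `𝓛 ∇φ(q) → 0` (`tendsto_norm_lapGrad`). By connectedness and convexity, a feasible point with
zero force is a minimizer; compactness turns small force and momentum into small distance to the
target. -/

theorem LipschitzOnWith.comp_absolutelyContinuousOnInterval {X Y : Type*} [PseudoMetricSpace X]
    [PseudoMetricSpace Y] {K : NNReal} {f : X → Y} {s : Set X} {x : ℝ → X} {a b : ℝ}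
    (hf : LipschitzOnWith K f s) (hx : AbsolutelyContinuousOnInterval x a b)
    (hs : MapsTo x (uIcc a b) s) : AbsolutelyContinuousOnInterval (f ∘ x) a b := by
  have h0 := Tendsto.const_mul (K : ℝ) hx
  rw [mul_zero] at h0
  refine squeeze_zero' (Eventually.of_forall fun E => Finset.sum_nonneg fun i _ => dist_nonneg)
    ?_ h0
  filter_upwards [mem_inf_of_right (mem_principal_self _)] with E hE
  rw [Finset.mul_sum]
  refine Finset.sum_le_sum fun i hi => ?_
  exact hf.dist_le_mul _ (hs (hE.1 i hi).1) _ (hs (hE.1 i hi).2)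

/-- A `C¹` map is locally Lipschitz, hence Lipschitz on the compact image of the curve. -/
theorem ContDiff.comp_absolutelyContinuousOnInterval {X Y : Type*} [NormedAddCommGroup X]
    [NormedSpace ℝ X] [NormedAddCommGroup Y] [NormedSpace ℝ Y] {f : X → Y} {x : ℝ → X} {a b : ℝ}
    (hf : ContDiff ℝ 1 f) (hx : AbsolutelyContinuousOnInterval x a b) :
    AbsolutelyContinuousOnInterval (f ∘ x) a b := by
  obtain ⟨K, hK⟩ := LocallyLipschitzOn.exists_lipschitzOnWith_of_compact
    (isCompact_uIcc.image_of_continuousOn hx.continuousOn) hf.locallyLipschitz.locallyLipschitzOn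
  exact hK.comp_absolutelyContinuousOnInterval hx (mapsTo_image _ _)

theorem AbsolutelyContinuousOnInterval.sub_le_of_ae_hasDerivAt_le {f : ℝ → ℝ} {a b C : ℝ}
    (hf : AbsolutelyContinuousOnInterval f a b) (hab : a ≤ b)
    (h : ∀ᵐ t ∂volume.restrict (Icc a b), ∃ y ≤ C, HasDerivAt f y t) :
    f b - f a ≤ C * (b - a) := by
  rw [← hf.integral_deriv_eq_sub]
  have : ∫ _ in a..b, C = C * (b - a) := by simp [mul_comm]
  rw [← this]
  refine intervalIntegral.integral_mono_ae_restrict hab hf.intervalIntegrable_deriv (by simp) ?_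
  filter_upwards [h] with t ⟨y, hy, ht⟩
  rwa [ht.deriv]

/-! ### Growth estimates along solutions of a differential inclusion. -/

namespace DiffIncl

variable {X : Type*} [NormedAddCommGroup X]

theorem IsSolution.Icc_subset [NormedSpace ℝ X] {F : X → Set X} {C : Set X} {I : Set ℝ} {x : ℝ → X}
    (hx : IsSolution F C I x) {a b : ℝ} (ha : 0 ≤ a) (hb : b ∈ I) : Icc a b ⊆ I :=
  (Icc_subset_Icc_left ha).trans (hx.ordConnected.out hx.zero_mem hb)

/-- A bound on the derivative of `f` along the set-valued field bounds the increase of `f`. -/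
theorem IsSolution.sub_le [NormedSpace ℝ X] {F : X → Set X} {C : Set X} {I : Set ℝ} {x : ℝ → X}
    (hx : IsSolution F C I x) {f : X → ℝ} {f' : X → X → ℝ} (hf : ContDiff ℝ 1 f)
    (hf' : ∀ y v, fderiv ℝ f y v = f' y v) {a b B : ℝ} (ha : 0 ≤ a) (hab : a ≤ b) (hb : b ∈ I)
    (h : ∀ t ∈ Icc a b, ∀ v ∈ F (x t), f' (x t) v ≤ B) :
    f (x b) - f (x a) ≤ B * (b - a) := by
  have hI := hx.Icc_subset ha hb
  refine (hf.comp_absolutelyContinuousOnInterval (hx.absCont a (hI ⟨le_rfl, hab⟩) b hb)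
    ).sub_le_of_ae_hasDerivAt_le hab ?_
  filter_upwards [ae_restrict_of_ae_restrict_of_subset hI hx.deriv_mem,
    ae_restrict_mem measurableSet_Icc] with t ⟨v, hv, hd⟩ ht
  refine ⟨f' (x t) v, h t ht v hv, ?_⟩
  rw [← hf']
  exact ((hf.differentiable one_ne_zero (x t)).hasFDerivAt).comp_hasDerivAt t hd

/-- The case of a linear observable, used to test a component of the solution against a fixed
vector. -/
theorem IsSolution.inner_sub_le [NormedSpace ℝ X] {E : Type*} [NormedAddCommGroup E]
    [InnerProductSpace ℝ E] {F : X → Set X} {C : Set X} {I : Set ℝ} {x : ℝ → X}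
    (hx : IsSolution F C I x) (Q : X →L[ℝ] E) (u : E) {a b B : ℝ} (ha : 0 ≤ a) (hab : a ≤ b)
    (hb : b ∈ I) (h : ∀ t ∈ Icc a b, ∀ v ∈ F (x t), inner ℝ u (Q v) ≤ B) :
    inner ℝ u (Q (x b)) - inner ℝ u (Q (x a)) ≤ B * (b - a) :=
  hx.sub_le (f' := fun _ v => inner ℝ u (Q v)) ((innerSL ℝ u).comp Q).contDiff
    (fun y v => by rw [((innerSL ℝ u).comp Q).fderiv]; rfl) ha hab hb h

/-- A bound on the speeds makes a solution Lipschitz. -/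
theorem IsSolution.norm_sub_le [InnerProductSpace ℝ X] {F : X → Set X} {C : Set X} {I : Set ℝ}
    {x : ℝ → X} (hx : IsSolution F C I x) {a b B : ℝ} (hB : 0 ≤ B) (ha : 0 ≤ a) (hab : a ≤ b) (hb : b ∈ I)
    (h : ∀ t ∈ Icc a b, ∀ v ∈ F (x t), ‖v‖ ≤ B) :
    ‖x b - x a‖ ≤ B * (b - a) := by
  -- Pairing with the displacement itself reduces the norm bound to a scalar one.
  set u := x b - x a
  have key := hx.inner_sub_le (ContinuousLinearMap.id ℝ X) u (B := ‖u‖ * B) ha hab hb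
    (fun t ht v hv => (real_inner_le_norm u v).trans (by gcongr; exact h t ht v hv))
  rw [← inner_sub_right, ← map_sub, ContinuousLinearMap.id_apply, real_inner_self_eq_norm_sq] at key
  rcases (norm_nonneg u).eq_or_lt with h0 | h0
  · rw [← h0]
    exact mul_nonneg hB (sub_nonneg.2 hab)
  · nlinarith

end DiffIncl

/-! Topological lemmas. -/

/-- A function that is positive on a compact set off `A` can be small only near `A`. -/
theorem IsCompact.exists_pos_infDist_lt {X : Type*} [PseudoMetricSpace X] {K A : Set X}
    (hK : IsCompact K) {f : X → ℝ} (hf : ContinuousOn f K) (hA : ∀ x ∈ K, x ∉ A → 0 < f x)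
    {ε : ℝ} (hε : 0 < ε) :
    ∃ m > 0, ∀ x ∈ K, f x < m → Metric.infDist x A < ε := by
  have hc : IsCompact (K ∩ {x | ε ≤ Metric.infDist x A}) :=
    hK.inter_right (isClosed_le continuous_const (Metric.continuous_infDist_pt A))
  obtain ⟨m, hm, h⟩ := hc.exists_forall_le' (hf.mono inter_subset_left) (a := 0) fun x hx =>
    hA x hx.1 fun hxA => by
      have := hx.2
      rw [mem_ofPred_eq, Metric.infDist_zero_of_mem hxA] at this
      exact this.not_gt hε
  exact ⟨m, hm, fun x hx hfx => lt_of_not_ge fun hge => (h x ⟨hx, hge⟩).not_gt hfx⟩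

/-- Here `h` is a window length: fix it small enough to control `C * h`, then let `t → ∞`. -/
theorem tendsto_zero_of_forall_eventually_le {f : ℝ → ℝ} {C : ℝ} (a : ℝ → ℝ → ℝ)
    (hf : ∀ t, 0 ≤ f t) (ha : ∀ h, 0 < h → h ≤ 1 → Tendsto (a h) atTop (𝓝 0))
    (hfa : ∀ h, 0 < h → h ≤ 1 → ∀ᶠ t in atTop, f t ≤ a h t + C * h) :
    Tendsto f atTop (𝓝 0) := by
  rw [Metric.tendsto_nhds]
  intro ε hε
  have hC : 0 < |C| + 1 := by positivity
  set h := min 1 (ε / (2 * (|C| + 1)))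
  have h0 : 0 < h := lt_min one_pos (by positivity)
  have h1 : C * h ≤ ε / 2 := by
    calc C * h ≤ (|C| + 1) * (ε / (2 * (|C| + 1))) :=
          mul_le_mul (by linarith [le_abs_self C]) (min_le_right _ _) h0.le hC.le
      _ = ε / 2 := by field_simp
  filter_upwards [hfa h h0 (min_le_left _ _),
    (ha h h0 (min_le_left _ _)).eventually (gt_mem_nhds (half_pos hε))] with t h2 h3
  rw [Real.dist_0_eq_abs, abs_of_nonneg (hf t)]
  linarith

/-! Convexity and the Laplacian. -/

/-- On the line from `q` to `w`, the slope over `[0, 1]` dominates the derivative at `0`. -/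
theorem ConvexOn.add_inner_gradient_le {E : Type*} [NormedAddCommGroup E] [InnerProductSpace ℝ E]
    [CompleteSpace E] {φ : E → ℝ} (hφ : ConvexOn ℝ univ φ) {q : E} (hd : DifferentiableAt ℝ φ q)
    (w : E) : φ q + inner ℝ (∇ φ q) (w - q) ≤ φ w := by
  have hl : ConvexOn ℝ univ (φ ∘ AffineMap.lineMap (k := ℝ) q w) := hφ.comp_affineMap _
  have hd' : HasDerivAt (φ ∘ AffineMap.lineMap (k := ℝ) q w) (inner ℝ (∇ φ q) (w - q)) 0 := by
    have h1 := (AffineMap.hasDerivAt_lineMap (𝕜 := ℝ) (a := q) (b := w) (x := 0))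
    have h2 : HasFDerivAt φ (InnerProductSpace.toDual ℝ E (∇ φ q))
        (AffineMap.lineMap q w (0 : ℝ)) := by
      rw [AffineMap.lineMap_apply_zero]
      exact hd.hasGradientAt.hasFDerivAt
    exact h2.comp_hasDerivAt 0 h1
  have := hl.le_slope_of_hasDerivAt (mem_univ 0) (mem_univ 1) one_pos hd'
  simp only [slope_def_field, Function.comp_apply, AffineMap.lineMap_apply_zero,
    AffineMap.lineMap_apply_one, sub_zero, div_one] at this
  linarith

namespace HiHBM

variable {n : ℕ}

/-- The all-ones vector. -/
noncomputable def ones (n : ℕ) : EuclideanSpace ℝ (Fin n) := WithLp.toLp 2 fun _ => 1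

theorem inner_ones (w : EuclideanSpace ℝ (Fin n)) : inner ℝ (ones n) w = ∑ i, w i := by
  simp [ones, PiLp.inner_apply]

theorem mem_feasible_iff {d : ℝ} {q : EuclideanSpace ℝ (Fin n)} :
    q ∈ feasible n d ↔ inner ℝ (ones n) q = d := by
  rw [inner_ones]; rfl

theorem inner_self_ones : inner ℝ (ones n) (ones n) = (n : ℝ) := by
  rw [inner_ones]; simp [ones]

variable (G : SimpleGraph (Fin n)) [DecidableRel G.Adj]

/-- The Laplacian as a continuous linear operator. -/
noncomputable def lap : EuclideanSpace ℝ (Fin n) →L[ℝ] EuclideanSpace ℝ (Fin n) :=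
  LinearMap.toContinuousLinearMap (Matrix.toEuclideanLin (G.lapMatrix ℝ))

theorem lap_apply (w : EuclideanSpace ℝ (Fin n)) :
    lap G w = WithLp.toLp 2 ((G.lapMatrix ℝ).mulVec w.ofLp) := rfl

theorem inner_lap_comm (v w : EuclideanSpace ℝ (Fin n)) :
    inner ℝ (lap G v) w = inner ℝ v (lap G w) :=
  Matrix.isSymmetric_toEuclideanLin_iff.2 (G.isHermitian_lapMatrix ℝ) v w

theorem lap_ones : lap G (ones n) = 0 := by
  rw [lap_apply, ones]
  simp [SimpleGraph.lapMatrix_mulVec_const_eq_zero]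

variable {G}

theorem eq_smul_ones_of_lap_eq_zero (hG : G.Connected) {w : EuclideanSpace ℝ (Fin n)}
    (hw : lap G w = 0) : ∃ c : ℝ, w = c • ones n := by
  have h0 : (G.lapMatrix ℝ).mulVec w.ofLp = 0 := congrArg WithLp.ofLp hw
  rw [SimpleGraph.lapMatrix_mulVec_eq_zero_iff_forall_reachable] at h0
  obtain ⟨i⟩ := hG.nonempty
  refine ⟨w i, ?_⟩
  ext j
  simpa [ones] using h0 j i (hG.preconnected j i)

variable (G) in
theorem inner_lap_self_nonneg (w : EuclideanSpace ℝ (Fin n)) : 0 ≤ inner ℝ w (lap G w) := by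
  have := (SimpleGraph.posSemidef_lapMatrix ℝ G).dotProduct_mulVec_nonneg w.ofLp
  simpa [lap_apply, PiLp.inner_apply, dotProduct, mul_comm] using this

theorem lap_eq_zero_of_inner_eq_zero {w : EuclideanSpace ℝ (Fin n)}
    (hw : inner ℝ w (lap G w) = 0) : lap G w = 0 := by
  have h := (SimpleGraph.posSemidef_lapMatrix ℝ G).dotProduct_mulVec_zero_iff w.ofLp
  rw [lap_apply, h.1]
  · rfl
  · simpa [lap_apply, PiLp.inner_apply, dotProduct, mul_comm] using hw

/-- A coercive symmetric operator that inverts the Laplacian on the zero-sum vectors. -/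
theorem exists_lap_inverse (hG : G.Connected) :
    ∃ M : EuclideanSpace ℝ (Fin n) →L[ℝ] EuclideanSpace ℝ (Fin n),
      (∀ v w, inner ℝ (M v) w = inner ℝ v (M w)) ∧
      (∃ c > 0, ∀ w, c * ‖w‖ ^ 2 ≤ inner ℝ (M w) w) ∧
      ∀ p ∈ feasible n 0, ∀ w, inner ℝ (M p) (lap G w) = inner ℝ p w := by
  have hn : (n : ℝ) ≠ 0 := by
    obtain ⟨i⟩ := hG.nonempty
    exact_mod_cast (Fin.pos i).ne'
  -- The rank-one term `𝟏𝟏ᵀ` removes the kernel of the Laplacian, spanned by `𝟏`, so that `A` is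
  -- positive definite.
  let A : EuclideanSpace ℝ (Fin n) →L[ℝ] EuclideanSpace ℝ (Fin n) :=
    lap G + (innerSL ℝ (ones n)).smulRight (ones n)
  have hA : ∀ w, A w = lap G w + inner ℝ (ones n) w • ones n := fun w => rfl
  have hsymm : ∀ v w, inner ℝ (A v) w = inner ℝ v (A w) := fun v w => by
    simp only [hA, inner_add_left, inner_add_right, inner_smul_left, inner_smul_right,
      inner_lap_comm, real_inner_comm v (ones n)]
    simp [mul_comm]
  have hpos : ∀ w, w ≠ 0 → 0 < inner ℝ w (A w) := fun w hw => by
    have h1 := inner_lap_self_nonneg G w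
    have h2 : inner ℝ w (A w) = inner ℝ w (lap G w) + inner ℝ (ones n) w ^ 2 := by
      rw [hA, inner_add_right, inner_smul_right, real_inner_comm (ones n) w]; ring
    rw [h2]
    refine lt_of_le_of_ne (by positivity) fun h0 => hw ?_
    have h3 : inner ℝ w (lap G w) = 0 := by nlinarith [sq_nonneg (inner ℝ (ones n) w)]
    have h4 : inner ℝ (ones n) w = 0 := by
      rw [h3] at h0; simpa using h0.symm
    obtain ⟨c, rfl⟩ := eq_smul_ones_of_lap_eq_zero hG (lap_eq_zero_of_inner_eq_zero h3)
    rw [inner_smul_right, inner_self_ones] at h4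
    rw [(mul_eq_zero.1 h4).resolve_right hn, zero_smul]
  have hinj : Function.Injective A.toLinearMap := by
    rw [injective_iff_map_eq_zero]
    intro w hw
    by_contra hne
    have := hpos w hne
    rw [show A w = 0 from hw, inner_zero_right] at this
    exact this.false
  let e := LinearEquiv.ofInjectiveEndo A.toLinearMap hinj
  let M := LinearMap.toContinuousLinearMap e.symm.toLinearMap
  have hAM : ∀ w, A (M w) = w := fun w => e.apply_symm_apply w
  have hMA : ∀ w, M (A w) = w := fun w => e.symm_apply_apply w
  have hMsymm : ∀ v w, inner ℝ (M v) w = inner ℝ v (M w) := fun v w => by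
    conv_lhs => rw [← hAM w, ← hsymm, hAM]
  have hMpos : ∀ w, w ≠ 0 → 0 < inner ℝ (M w) w := fun w hw => by
    have hne : M w ≠ 0 := fun h0 => hw (by rw [← hAM w, h0, map_zero])
    have := hpos _ hne
    rwa [hAM] at this
  refine ⟨M, hMsymm, ?_, fun p hp w => ?_⟩
  · obtain ⟨c, hc, h⟩ := (isCompact_sphere (0 : EuclideanSpace ℝ (Fin n)) 1).exists_forall_le'
      (f := fun w => inner ℝ (M w) w) (by fun_prop) (a := 0)
      fun w hw => hMpos w fun h0 => by simp [h0] at hw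
    refine ⟨c, hc, fun w => ?_⟩
    rcases eq_or_ne w 0 with rfl | hw
    · simp
    have hw' : 0 < ‖w‖ := norm_pos_iff.2 hw
    have := h (‖w‖⁻¹ • w) (by simp [norm_smul, hw'.ne'])
    simp only [map_smul, inner_smul_left, inner_smul_right, RCLike.conj_to_real] at this
    calc c * ‖w‖ ^ 2 ≤ (‖w‖⁻¹ * (‖w‖⁻¹ * inner ℝ (M w) w)) * ‖w‖ ^ 2 := by gcongr
      _ = inner ℝ (M w) w := by field_simp
  -- `𝟏` is an eigenvector of `A` with eigenvalue `n`, so `M` preserves its span and the rank-one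
  -- correction pairs to zero with a zero-sum `p`.
  · have hones : M (ones n) = (n : ℝ)⁻¹ • ones n := by
      have : A (ones n) = (n : ℝ) • ones n := by rw [hA, lap_ones, inner_self_ones, zero_add]
      have h2 := hMA (ones n)
      rw [this, map_smul] at h2
      conv_rhs => rw [← h2, smul_smul, inv_mul_cancel₀ hn, one_smul]
    have h3 : lap G w = A w - inner ℝ (ones n) w • ones n := by rw [hA]; abel
    rw [h3, inner_sub_right, inner_smul_right, hMsymm p (A w), hMA, hMsymm p (ones n), hones,
      inner_smul_right, real_inner_comm (ones n) p, mem_feasible_iff.1 hp]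
    ring

end HiHBM

namespace HiHBM

variable {n : ℕ} {G : SimpleGraph (Fin n)} [DecidableRel G.Adj]
  {φ : EuclideanSpace ℝ (Fin n) → ℝ} {d Kmin Kmax : ℝ}

/-- The position component as a continuous linear map. -/
noncomputable def position (n : ℕ) : State n →L[ℝ] EuclideanSpace ℝ (Fin n) :=
  WithLp.fstL 2 ℝ (EuclideanSpace ℝ (Fin n)) (EuclideanSpace ℝ (Fin n))

/-- The momentum component as a continuous linear map. -/
noncomputable def momentum (n : ℕ) : State n →L[ℝ] EuclideanSpace ℝ (Fin n) :=
  WithLp.sndL 2 ℝ (EuclideanSpace ℝ (Fin n)) (EuclideanSpace ℝ (Fin n))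

/-! The set of minimizers. -/

theorem isClosed_feasible (n : ℕ) (d : ℝ) : IsClosed (feasible n d) :=
  isClosed_eq (by fun_prop) continuous_const

theorem isClosed_flowSet (n : ℕ) (d : ℝ) : IsClosed (flowSet n d) :=
  ((isClosed_feasible n d).preimage (position n).continuous).inter
    ((isClosed_feasible n 0).preimage (momentum n).continuous)

theorem minimizers_nonempty (hn : n ≠ 0) (hφ : Continuous φ)
    (hc : ∀ c : ℝ, IsCompact {q | φ q ≤ c}) : (minimizers φ d).Nonempty := by
  have hn' : (n : ℝ) ≠ 0 := Nat.cast_ne_zero.2 hn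
  have h0 : (d / n) • ones n ∈ feasible n d := by
    rw [mem_feasible_iff, inner_smul_right, inner_self_ones, div_mul_cancel₀ _ hn']
  obtain ⟨q, hq, hmin⟩ := ((hc (φ ((d / n) • ones n))).inter_right
    (isClosed_feasible n d)).exists_isMinOn ⟨_, le_refl (φ _), h0⟩ hφ.continuousOn
  refine ⟨q, hq.2, fun w hw => ?_⟩
  rcases le_total (φ w) (φ ((d / n) • ones n)) with h | h
  · exact hmin ⟨h, hw⟩
  · exact (show φ q ≤ _ from hq.1).trans h

theorem mem_minimizers_iff {q₀ q : EuclideanSpace ℝ (Fin n)} (h₀ : q₀ ∈ minimizers φ d) :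
    q ∈ minimizers φ d ↔ q ∈ feasible n d ∧ φ q ≤ φ q₀ :=
  ⟨fun h => ⟨h.1, h.2 _ h₀.1⟩, fun h => ⟨h.1, fun w hw => h.2.trans (h₀.2 w hw)⟩⟩

/-- Feasible points at which the gradient is balanced over the network are minimizers. -/
theorem mem_minimizers_of_lapGrad_eq_zero (hG : G.Connected) (hφ : ContDiff ℝ 1 φ)
    (hconv : ConvexOn ℝ univ φ) {q : EuclideanSpace ℝ (Fin n)} (hq : q ∈ feasible n d)
    (h : lapGrad G φ q = 0) : q ∈ minimizers φ d := by
  refine ⟨hq, fun w hw => ?_⟩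
  obtain ⟨c, hc⟩ := eq_smul_ones_of_lap_eq_zero hG (show lap G (∇ φ q) = 0 from h)
  have := hconv.add_inner_gradient_le (hφ.differentiable one_ne_zero q) w
  rw [hc, inner_smul_left, inner_sub_right, mem_feasible_iff.1 hw, mem_feasible_iff.1 hq] at this
  simpa using this

theorem isCompact_target (hn : n ≠ 0) (hφ : Continuous φ)
    (hc : ∀ c : ℝ, IsCompact {q | φ q ≤ c}) : IsCompact (target φ d) := by
  obtain ⟨q₀, h₀⟩ := minimizers_nonempty (d := d) hn hφ hc
  have h : target φ d =
      (fun q => (WithLp.toLp 2 (q, 0) : State n)) '' ({q | φ q ≤ φ q₀} ∩ feasible n d) := by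
    ext x
    constructor
    · rintro ⟨hq, hp⟩
      refine ⟨x.fst, ((mem_minimizers_iff h₀).1 hq).symm, ?_⟩
      simp only [← hp]
      rfl
    · rintro ⟨q, hq, rfl⟩
      exact ⟨(mem_minimizers_iff h₀).2 hq.symm, rfl⟩
  rw [h]
  refine ((hc _).inter_right (isClosed_feasible n d)).image ?_
  exact (WithLp.prod_continuous_toLp 2 _ _).comp (by fun_prop)

/-! The energy function. -/

/-- Symmetry of `M` merges the two terms of the product rule, which cancels the factor `1 / 2`. -/
theorem fderiv_comp_add_half_inner {X E : Type*} [NormedAddCommGroup X] [NormedSpace ℝ X]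
    [NormedAddCommGroup E] [InnerProductSpace ℝ E] [CompleteSpace E] {φ : E → ℝ}
    (hφ : Differentiable ℝ φ) (P Q : X →L[ℝ] E) {M : E →L[ℝ] E}
    (hM : ∀ v w, inner ℝ (M v) w = inner ℝ v (M w)) (y v : X) :
    fderiv ℝ (fun x => φ (P x) + 1 / 2 * inner ℝ (M (Q x)) (Q x)) y v =
      inner ℝ (∇ φ (P y)) (P v) + inner ℝ (M (Q y)) (Q v) := by
  have h1 := (hφ (P y)).hasGradientAt.hasFDerivAt.comp y P.hasFDerivAt
  have h2 := (((M.comp Q).hasFDerivAt (x := y)).inner ℝ Q.hasFDerivAt).const_mul (1 / 2 : ℝ)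
  have h3 : HasFDerivAt (fun x => φ (P x) + 1 / 2 * inner ℝ (M (Q x)) (Q x)) _ y := h1.add h2
  have h4 : inner ℝ (M (Q v)) (Q y) = inner ℝ (M (Q y)) (Q v) := by rw [hM, real_inner_comm]
  rw [h3.fderiv]
  change inner ℝ (∇ φ (P y)) (P v) +
    1 / 2 * (inner ℝ (M (Q y)) (Q v) + inner ℝ (M (Q v)) (Q y)) = _
  rw [h4]
  ring

/-- The energy `φ(q) + ⟪M p, p⟫ / 2`. -/
noncomputable def energy (φ : EuclideanSpace ℝ (Fin n) → ℝ)
    (M : EuclideanSpace ℝ (Fin n) →L[ℝ] EuclideanSpace ℝ (Fin n)) (x : State n) : ℝ :=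
  φ x.fst + 1 / 2 * inner ℝ (M x.snd) x.snd

variable {M : EuclideanSpace ℝ (Fin n) →L[ℝ] EuclideanSpace ℝ (Fin n)} {c : ℝ}

theorem contDiff_energy (hφ : ContDiff ℝ 1 φ) : ContDiff ℝ 1 (energy φ M) := by
  have h1 : ContDiff ℝ 1 fun x : State n => x.fst := (position n).contDiff
  have h2 : ContDiff ℝ 1 fun x : State n => x.snd := (momentum n).contDiff
  exact (hφ.comp h1).add (contDiff_const.mul ((M.contDiff.comp h2).inner ℝ h2))

theorem fderiv_energy (hφ : ContDiff ℝ 1 φ) (hM : ∀ v w, inner ℝ (M v) w = inner ℝ v (M w))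
    (y v : State n) :
    fderiv ℝ (energy φ M) y v = inner ℝ (∇ φ y.fst) v.fst + inner ℝ (M y.snd) v.snd := by
  exact fderiv_comp_add_half_inner (hφ.differentiable one_ne_zero) (position n) (momentum n) hM y v

theorem exists_of_mem_flowMap (hK : Kmin ≤ Kmax) {x v : State n}
    (hv : v ∈ flowMap G φ Kmin Kmax x) :
    ∃ k ∈ Icc Kmin Kmax, v.fst = x.snd ∧ v.snd = -(k • x.snd) - lapGrad G φ x.fst := by
  obtain ⟨k, hk, rfl⟩ := hv
  refine ⟨k, ?_, rfl, rfl⟩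
  unfold damping at hk
  split_ifs at hk
  · rw [mem_singleton_iff.1 hk]; exact ⟨hK, le_rfl⟩
  · rw [mem_singleton_iff.1 hk]; exact ⟨le_rfl, hK⟩
  · exact hk

theorem energy_decay (hKmin : 0 < Kmin) (hK : Kmin ≤ Kmax) (hc : 0 < c)
    (hMc : ∀ w, c * ‖w‖ ^ 2 ≤ inner ℝ (M w) w)
    (hML : ∀ p ∈ feasible n 0, ∀ w, inner ℝ (M p) (lap G w) = inner ℝ p w)
    {x v : State n} (hx : x ∈ flowSet n d) (hv : v ∈ flowMap G φ Kmin Kmax x) :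
    inner ℝ (∇ φ x.fst) v.fst + inner ℝ (M x.snd) v.snd ≤ -(Kmin * c * ‖x.snd‖ ^ 2) := by
  obtain ⟨k, hk, h1, h2⟩ := exists_of_mem_flowMap hK hv
  have h3 : inner ℝ (M x.snd) (lapGrad G φ x.fst) = inner ℝ (∇ φ x.fst) x.snd := by
    rw [real_inner_comm x.snd]; exact hML _ hx.2 _
  rw [h1, h2, inner_sub_right, inner_neg_right, inner_smul_right, h3]
  have h4 : Kmin * (c * ‖x.snd‖ ^ 2) ≤ k * inner ℝ (M x.snd) x.snd :=
    mul_le_mul hk.1 (hMc _) (by positivity) (hKmin.le.trans hk.1)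
  linarith

/-- The kinetic term is nonnegative, so `q` lies in a compact sublevel set of `φ`; the minimum of
`φ` bounds the potential below, so coercivity of `M` bounds `p`. -/
theorem isCompact_energy_sublevel (hn : n ≠ 0) (hφ : ContDiff ℝ 1 φ)
    (hcomp : ∀ c : ℝ, IsCompact {q | φ q ≤ c}) (hc : 0 < c)
    (hMc : ∀ w, c * ‖w‖ ^ 2 ≤ inner ℝ (M w) w) (d r : ℝ) :
    IsCompact {x | x ∈ flowSet n d ∧ energy φ M x ≤ r} := by
  obtain ⟨q₀, h₀⟩ := minimizers_nonempty (d := d) hn hφ.continuous hcomp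
  refine Metric.isCompact_of_isClosed_isBounded ((isClosed_flowSet n d).inter
    (isClosed_le (contDiff_energy hφ).continuous continuous_const)) ?_
  obtain ⟨R, hR⟩ := (hcomp r).isBounded.exists_norm_le
  rw [isBounded_iff_forall_norm_le]
  refine ⟨√(R ^ 2 + 2 * (r - φ q₀) / c), fun x hx => Real.le_sqrt_of_sq_le ?_⟩
  have h1 := h₀.2 _ hx.1.1
  have h2 := hMc x.snd
  have h3 : φ x.fst + 1 / 2 * inner ℝ (M x.snd) x.snd ≤ r := hx.2
  have h4 : 0 ≤ c * ‖x.snd‖ ^ 2 := by positivity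
  rw [WithLp.prod_norm_sq_eq_of_L2]
  refine add_le_add ?_ ?_
  · have := hR x.fst (show φ x.fst ≤ r by linarith)
    gcongr
  · rw [le_div_iff₀ hc]
    linarith

/-! Asymptotic behaviour of solutions. -/

theorem lipschitzWith_lapGrad {L : NNReal} (hφ : LipschitzWith L (∇ φ)) :
    LipschitzWith (‖lap G‖₊ * L) (lapGrad G φ) :=
  (lap G).lipschitz.comp hφ

theorem exists_norm_flowMap_le {L : NNReal} (hφ : LipschitzWith L (∇ φ)) (hKmin : 0 < Kmin)
    (hK : Kmin ≤ Kmax) {K : Set (State n)} (hKc : IsCompact K) :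
    ∃ B, 0 ≤ B ∧ ∀ x ∈ K, ∀ v ∈ flowMap G φ Kmin Kmax x, ‖v‖ ≤ B := by
  have hg : Continuous fun x : State n => lapGrad G φ x.fst :=
    (lipschitzWith_lapGrad hφ).continuous.comp (position n).continuous
  have hs : Continuous fun x : State n => x.snd := (momentum n).continuous
  obtain ⟨B, hB⟩ := hKc.exists_bound_of_continuousOn
    (f := fun x : State n => ‖x.snd‖ + (Kmax * ‖x.snd‖ + ‖lapGrad G φ x.fst‖))
    (by fun_prop)
  refine ⟨max B 0, le_max_right _ _, fun x hx v hv => le_max_of_le_left ?_⟩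
  obtain ⟨k, hk, h1, h2⟩ := exists_of_mem_flowMap hK hv
  have h3 : ‖v‖ ≤ ‖v.fst‖ + ‖v.snd‖ := by
    refine abs_le_of_sq_le_sq' ?_ (by positivity) |>.2
    rw [WithLp.prod_norm_sq_eq_of_L2]
    nlinarith [norm_nonneg v.fst, norm_nonneg v.snd]
  have h4 : ‖v.snd‖ ≤ Kmax * ‖x.snd‖ + ‖lapGrad G φ x.fst‖ := by
    rw [h2]
    refine (norm_sub_le _ _).trans (add_le_add_left ?_ _)
    rw [norm_neg, norm_smul, Real.norm_of_nonneg (hKmin.le.trans hk.1)]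
    gcongr
    exact hk.2
  rw [h1] at h3
  exact (h3.trans (by gcongr)).trans ((le_abs_self _).trans (hB x hx))

variable {I : Set ℝ} {x : ℝ → State n}

theorem energy_sub_le (hφ : ContDiff ℝ 1 φ) (hKmin : 0 < Kmin) (hK : Kmin ≤ Kmax) (hc : 0 < c)
    (hM : ∀ v w, inner ℝ (M v) w = inner ℝ v (M w))
    (hMc : ∀ w, c * ‖w‖ ^ 2 ≤ inner ℝ (M w) w)
    (hML : ∀ p ∈ feasible n 0, ∀ w, inner ℝ (M p) (lap G w) = inner ℝ p w)
    (hx : DiffIncl.IsSolution (flowMap G φ Kmin Kmax) (flowSet n d) I x) {a b B : ℝ}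
    (ha : 0 ≤ a) (hab : a ≤ b) (hb : b ∈ I) (hB : ∀ t ∈ Icc a b, B ≤ ‖(x t).snd‖ ^ 2) :
    energy φ M (x b) - energy φ M (x a) ≤ -(Kmin * c * B) * (b - a) := by
  refine hx.sub_le (contDiff_energy hφ) (fderiv_energy hφ hM) ha hab hb fun t ht v hv =>
    (energy_decay hKmin hK hc hMc hML (hx.mem t (hx.Icc_subset ha hb ht)) hv).trans ?_
  have := hB t ht
  gcongr

theorem energy_le (hφ : ContDiff ℝ 1 φ) (hKmin : 0 < Kmin) (hK : Kmin ≤ Kmax) (hc : 0 < c)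
    (hM : ∀ v w, inner ℝ (M v) w = inner ℝ v (M w))
    (hMc : ∀ w, c * ‖w‖ ^ 2 ≤ inner ℝ (M w) w)
    (hML : ∀ p ∈ feasible n 0, ∀ w, inner ℝ (M p) (lap G w) = inner ℝ p w)
    (hx : DiffIncl.IsSolution (flowMap G φ Kmin Kmax) (flowSet n d) I x) {a b : ℝ}
    (ha : 0 ≤ a) (hab : a ≤ b) (hb : b ∈ I) : energy φ M (x b) ≤ energy φ M (x a) := by
  have := energy_sub_le hφ hKmin hK hc hM hMc hML hx ha hab hb (B := 0) fun t _ => sq_nonneg _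
  simpa using this

/-- Along a complete solution of bounded speed the momentum vanishes asymptotically. -/
theorem tendsto_norm_snd (hφ : ContDiff ℝ 1 φ) (hKmin : 0 < Kmin) (hK : Kmin ≤ Kmax) (hc : 0 < c)
    (hM : ∀ v w, inner ℝ (M v) w = inner ℝ v (M w))
    (hMc : ∀ w, c * ‖w‖ ^ 2 ≤ inner ℝ (M w) w)
    (hML : ∀ p ∈ feasible n 0, ∀ w, inner ℝ (M p) (lap G w) = inner ℝ p w)
    (hx : DiffIncl.IsSolution (flowMap G φ Kmin Kmax) (flowSet n d) I x) (hI : Ici 0 ⊆ I)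
    {m B : ℝ} (hm : ∀ t ∈ I, m ≤ energy φ M (x t))
    (hB : ∀ a b, 0 ≤ a → a ≤ b → ‖x b - x a‖ ≤ B * (b - a)) :
    Tendsto (fun t => ‖(x t).snd‖) atTop (𝓝 0) := by
  -- Clamping time at `0` gives a function that is monotone on all of `ℝ`.
  have hanti : Antitone fun t => energy φ M (x (max t 0)) := fun s t hst =>
    energy_le hφ hKmin hK hc hM hMc hML hx (le_max_right _ _) (max_le_max_right 0 hst)
      (hI (le_max_right t 0))
  obtain ⟨l, hl⟩ : ∃ l, Tendsto (fun t => energy φ M (x t)) atTop (𝓝 l) := by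
    refine ⟨_, (tendsto_atTop_ciInf hanti ⟨m, ?_⟩).congr' ?_⟩
    · rintro _ ⟨t, rfl⟩
      exact hm _ (hI (le_max_right t 0))
    · filter_upwards [eventually_ge_atTop 0] with t ht
      rw [max_eq_left ht]
  have hsq : Tendsto (fun t => ‖(x t).snd‖ ^ 2) atTop (𝓝 0) := by
    refine tendsto_zero_of_forall_eventually_le (C := 2 * B ^ 2)
      (fun h t => 2 / (Kmin * c * h) * (energy φ M (x t) - energy φ M (x (t + h))))
      (fun t => by positivity) (fun h h0 h1 => ?_) (fun h h0 h1 => ?_)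
    · have := (hl.sub (hl.comp (tendsto_atTop_add_const_right atTop h tendsto_id))).const_mul
        (2 / (Kmin * c * h))
      simpa using this
    · filter_upwards [eventually_ge_atTop 0] with t ht
      -- On the window `p` moves by at most `B h`, and `a² ≤ 2b² + 2(a - b)²` bounds `‖p(s)‖²` below
      -- by `‖p(t)‖² / 2 - B² h²`.
      have key := energy_sub_le hφ hKmin hK hc hM hMc hML hx ht (by linarith : t ≤ t + h)
        (hI (by simp only [mem_Ici]; linarith)) (B := ‖(x t).snd‖ ^ 2 / 2 - B ^ 2 * h ^ 2)
        fun s hs => by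
          have h2 : ‖(x s).snd - (x t).snd‖ ≤ B * (s - t) :=
            (WithLp.norm_snd_le _ (x s - x t)).trans (hB t s ht hs.1)
          have h3 : ‖(x t).snd‖ ≤ ‖(x s).snd‖ + ‖(x s).snd - (x t).snd‖ := by
            exact norm_le_norm_add_norm_sub _ _
          have h4 : ‖(x s).snd - (x t).snd‖ ^ 2 ≤ B ^ 2 * h ^ 2 := by
            calc _ ≤ (B * (s - t)) ^ 2 := by gcongr
              _ = B ^ 2 * (s - t) ^ 2 := by ring
              _ ≤ B ^ 2 * h ^ 2 := by
                have := sub_nonneg.2 hs.1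
                have : s - t ≤ h := by linarith [hs.2]
                gcongr
          have h5 : ‖(x t).snd‖ ^ 2 ≤ (‖(x s).snd‖ + ‖(x s).snd - (x t).snd‖) ^ 2 := by gcongr
          nlinarith [sq_nonneg (‖(x s).snd‖ - ‖(x s).snd - (x t).snd‖)]
      have hpos : 0 < Kmin * c * h := by positivity
      have h6 : ‖(x t).snd‖ ^ 2 / 2 - B ^ 2 * h ^ 2 ≤
          (energy φ M (x t) - energy φ M (x (t + h))) / (Kmin * c * h) := by
        rw [le_div_iff₀ hpos]
        linarith
      have h7 : B ^ 2 * h ^ 2 ≤ B ^ 2 * h := by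
        gcongr
        nlinarith
      calc ‖(x t).snd‖ ^ 2 ≤ 2 * ((energy φ M (x t) - energy φ M (x (t + h))) / (Kmin * c * h)) +
            2 * (B ^ 2 * h) := by linarith
        _ = _ := by ring
  simpa using hsq.sqrt

/-- Along a complete solution of bounded speed with vanishing momentum, the force vanishes
asymptotically. -/
theorem tendsto_norm_lapGrad {L : NNReal} (hφ : LipschitzWith L (∇ φ)) (hKmin : 0 < Kmin)
    (hK : Kmin ≤ Kmax)
    (hx : DiffIncl.IsSolution (flowMap G φ Kmin Kmax) (flowSet n d) I x) (hI : Ici 0 ⊆ I)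
    {B : ℝ} (hB : ∀ a b, 0 ≤ a → a ≤ b → ‖x b - x a‖ ≤ B * (b - a)) (hB0 : 0 ≤ B)
    (hp : Tendsto (fun t => ‖(x t).snd‖) atTop (𝓝 0)) :
    Tendsto (fun t => ‖lapGrad G φ (x t).fst‖) atTop (𝓝 0) := by
  set Lg : ℝ := ‖lap G‖ * L
  have hLg : 0 ≤ Lg := by positivity
  have hKmax : 0 ≤ Kmax := hKmin.le.trans hK
  refine tendsto_zero_of_forall_eventually_le (C := Kmax * B + Lg * B)
    (fun h t => (‖(x (t + h)).snd‖ + ‖(x t).snd‖) / h + Kmax * ‖(x t).snd‖)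
    (fun t => norm_nonneg _) (fun h h0 h1 => ?_) (fun h h0 h1 => ?_)
  · have := (((hp.comp (tendsto_atTop_add_const_right atTop h tendsto_id)).add hp).div_const h).add
      (hp.const_mul Kmax)
    simpa using this
  · filter_upwards [eventually_ge_atTop 0] with t ht
    set u := lapGrad G φ (x t).fst
    -- With the force frozen at time `t` as `u`, the derivative of `⟪u, p⟫` is `-‖u‖²` up to damping
    -- and the Lipschitz variation of the force.
    have key := hx.inner_sub_le (momentum n) u
      (B := ‖u‖ * (Kmax * (‖(x t).snd‖ + B * h) + Lg * (B * h) - ‖u‖)) ht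
      (by linarith : t ≤ t + h) (hI (by simp only [mem_Ici]; linarith))
      fun s hs v hv => by
        change inner ℝ u v.snd ≤ _
        obtain ⟨k, hk, -, h2⟩ := exists_of_mem_flowMap hK hv
        have hst : B * (s - t) ≤ B * h := by
          have : s - t ≤ h := by linarith [hs.2]
          gcongr
        have h3 : ‖(x s).snd‖ ≤ ‖(x t).snd‖ + B * h := by
          have h4 : ‖(x s).snd - (x t).snd‖ ≤ B * (s - t) :=
            (WithLp.norm_snd_le _ (x s - x t)).trans (hB t s ht hs.1)
          linarith [norm_le_norm_add_norm_sub' (x s).snd (x t).snd, norm_sub_rev (x s).snd (x t).snd]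
        have h4 : ‖lapGrad G φ (x s).fst - u‖ ≤ Lg * (B * h) := by
          refine ((lipschitzWith_lapGrad hφ).norm_sub_le _ _).trans ?_
          have h5 : ‖(x s).fst - (x t).fst‖ ≤ B * (s - t) :=
            (WithLp.norm_fst_le _ (x s - x t)).trans (hB t s ht hs.1)
          exact mul_le_mul_of_nonneg_left (h5.trans hst) hLg
        have h5 : v.snd = -(k • (x s).snd) - (lapGrad G φ (x s).fst - u) - u := by
          rw [h2]; abel
        have h6 : -(k * inner ℝ u (x s).snd) ≤ ‖u‖ * (Kmax * (‖(x t).snd‖ + B * h)) := by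
          have h7 := neg_le_of_abs_le (abs_real_inner_le_norm u (x s).snd)
          calc -(k * inner ℝ u (x s).snd) = k * -inner ℝ u (x s).snd := by ring
            _ ≤ k * (‖u‖ * ‖(x s).snd‖) :=
              mul_le_mul_of_nonneg_left (by linarith) (hKmin.le.trans hk.1)
            _ ≤ Kmax * (‖u‖ * (‖(x t).snd‖ + B * h)) :=
              mul_le_mul hk.2 (by gcongr) (by positivity) hKmax
            _ = _ := by ring
        have h8 : -inner ℝ u (lapGrad G φ (x s).fst - u) ≤ ‖u‖ * (Lg * (B * h)) := by
          have h7 := neg_le_of_abs_le (abs_real_inner_le_norm u (lapGrad G φ (x s).fst - u))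
          have : ‖u‖ * ‖lapGrad G φ (x s).fst - u‖ ≤ ‖u‖ * (Lg * (B * h)) := by gcongr
          linarith
        rw [h5, inner_sub_right, inner_sub_right, inner_neg_right, inner_smul_right,
          real_inner_self_eq_norm_sq]
        linarith
    change inner ℝ u (x (t + h)).snd - inner ℝ u (x t).snd ≤ _ at key
    have h1' := abs_le.1 (abs_real_inner_le_norm u (x (t + h)).snd)
    have h2' := abs_le.1 (abs_real_inner_le_norm u (x t).snd)
    -- A factor `‖u‖` is about to be cancelled.
    rcases (norm_nonneg u).eq_or_lt with hu | hu
    · rw [← hu]; positivity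
    have h9 : ‖u‖ * (h * ‖u‖) ≤ ‖u‖ * (‖(x (t + h)).snd‖ + ‖(x t).snd‖ +
        (Kmax * (‖(x t).snd‖ + B * h) + Lg * (B * h)) * h) := by
      linarith
    have h10 := le_of_mul_le_mul_left h9 hu
    have h11 : ‖u‖ ≤ (‖(x (t + h)).snd‖ + ‖(x t).snd‖ +
        (Kmax * (‖(x t).snd‖ + B * h) + Lg * (B * h)) * h) / h := by
      rw [le_div_iff₀ h0]; linarith
    refine h11.trans_eq ?_
    field_simp
    ring

theorem boundedAndConverges {L : NNReal} (hG : G.Connected) (hφ : ContDiff ℝ 1 φ)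
    (hcomp : ∀ c : ℝ, IsCompact {q | φ q ≤ c}) (hlip : LipschitzWith L (∇ φ))
    (hconv : ConvexOn ℝ univ φ) (hKmin : 0 < Kmin) (hK : Kmin ≤ Kmax)
    (hx : DiffIncl.IsSolution (flowMap G φ Kmin Kmax) (flowSet n d) I x) :
    DiffIncl.BoundedAndConverges I x (target φ d) := by
  have hn : n ≠ 0 := by
    obtain ⟨i⟩ := hG.nonempty
    exact (Fin.pos i).ne'
  obtain ⟨q₀, h₀⟩ := minimizers_nonempty (d := d) hn hφ.continuous hcomp
  obtain ⟨M, hM, ⟨c, hc, hMc⟩, hML⟩ := exists_lap_inverse hG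
  have hcpt := isCompact_energy_sublevel hn hφ hcomp hc hMc d (energy φ M (x 0))
  have hmem : ∀ t ∈ I, x t ∈ {y | y ∈ flowSet n d ∧ energy φ M y ≤ energy φ M (x 0)} :=
    fun t ht => ⟨hx.mem t ht,
      energy_le hφ hKmin hK hc hM hMc hML hx le_rfl (hx.nonneg t ht) ht⟩
  refine ⟨hcpt.isBounded.subset (image_subset_iff.2 hmem), fun hI => ?_⟩
  have hI : Ici 0 ⊆ I := fun t ht => by
    obtain ⟨s, hs, hts⟩ := not_bddAbove_iff.1 hI t
    exact hx.Icc_subset le_rfl hs ⟨ht, hts.le⟩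
  obtain ⟨B, hB0, hB⟩ := exists_norm_flowMap_le (G := G) hlip hKmin hK hcpt
  have hspeed : ∀ a b, 0 ≤ a → a ≤ b → ‖x b - x a‖ ≤ B * (b - a) := fun a b ha hab =>
    hx.norm_sub_le hB0 ha hab (hI (ha.trans hab)) fun t ht =>
      hB _ (hmem t (hI (ha.trans ht.1)))
  have hm : ∀ t ∈ I, φ q₀ ≤ energy φ M (x t) := fun t ht => by
    have h1 := h₀.2 _ (hx.mem t ht).1
    have h2 := hMc (x t).snd
    have h3 : 0 ≤ c * ‖(x t).snd‖ ^ 2 := by positivity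
    unfold energy
    linarith
  have hp := tendsto_norm_snd hφ hKmin hK hc hM hMc hML hx hI hm hspeed
  have hg := tendsto_norm_lapGrad hlip hKmin hK hx hI hspeed hB0 hp
  have hgc : Continuous fun y : State n => lapGrad G φ y.fst :=
    (lipschitzWith_lapGrad hlip).continuous.comp (position n).continuous
  have hsc : Continuous fun y : State n => y.snd := (momentum n).continuous
  rw [Metric.tendsto_nhds]
  intro ε hε
  obtain ⟨m, hm0, hmε⟩ := hcpt.exists_pos_infDist_lt (A := target φ d)
    (f := fun y : State n => ‖lapGrad G φ y.fst‖ + ‖y.snd‖) (by fun_prop) (fun y hy hyA => by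
      by_contra hle
      have h1 : ‖lapGrad G φ y.fst‖ = 0 := by
        linarith [norm_nonneg (lapGrad G φ y.fst), norm_nonneg y.snd]
      have h2 : ‖y.snd‖ = 0 := by
        linarith [norm_nonneg (lapGrad G φ y.fst), norm_nonneg y.snd]
      exact hyA ⟨mem_minimizers_of_lapGrad_eq_zero hG hφ hconv hy.1.1 (norm_eq_zero.1 h1),
        norm_eq_zero.1 h2⟩) hε
  have hlim := hg.add hp
  rw [add_zero] at hlim
  filter_upwards [hlim.eventually (gt_mem_nhds hm0), eventually_ge_atTop 0] with t h1 h2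
  rw [Real.dist_0_eq_abs, abs_of_nonneg Metric.infDist_nonneg]
  exact hmε _ (hmem t (hI h2)) h1

/-- Near the target the energy is barely above its minimum and cannot increase; low energy in a
compact sublevel set forces proximity to the target. -/
theorem isStable (hG : G.Connected) (hφ : ContDiff ℝ 1 φ)
    (hcomp : ∀ c : ℝ, IsCompact {q | φ q ≤ c}) (hKmin : 0 < Kmin) (hK : Kmin ≤ Kmax) :
    DiffIncl.IsStable (flowMap G φ Kmin Kmax) (flowSet n d) (target φ d) := by
  have hn : n ≠ 0 := by
    obtain ⟨i⟩ := hG.nonempty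
    exact (Fin.pos i).ne'
  obtain ⟨q₀, h₀⟩ := minimizers_nonempty (d := d) hn hφ.continuous hcomp
  obtain ⟨M, hM, ⟨c, hc, hMc⟩, hML⟩ := exists_lap_inverse hG
  have hne : (target φ d).Nonempty := ⟨WithLp.toLp 2 (q₀, 0), h₀, rfl⟩
  have hcont := (contDiff_energy (M := M) hφ).continuous
  intro ε hε
  -- The level `φ q₀ + 1` is an arbitrary one above the minimum; `min m 1` below keeps solutions
  -- inside it.
  obtain ⟨m, hm, hmε⟩ := (isCompact_energy_sublevel hn hφ hcomp hc hMc d (φ q₀ + 1)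
    ).exists_pos_infDist_lt (A := target φ d) (f := fun y => energy φ M y - φ q₀)
    (by fun_prop) (fun y hy hyA => by
      by_contra hle
      have h1 := h₀.2 _ hy.1.1
      have h2 := hMc y.snd
      have h3 : 0 ≤ c * ‖y.snd‖ ^ 2 := by positivity
      unfold energy at hle
      have h4 : c * ‖y.snd‖ ^ 2 = 0 := by linarith
      refine hyA ⟨(mem_minimizers_iff h₀).2 ⟨hy.1.1, by linarith⟩, ?_⟩
      simpa [hc.ne'] using h4) hε
  -- A closed thickening is taken because stability allows initial distance equal to `δ`.
  obtain ⟨δ, hδ, hsub⟩ := (isCompact_target hn hφ.continuous hcomp).exists_cthickening_subset_open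
    (isOpen_lt hcont (continuous_const (y := φ q₀ + min m 1))) fun y hy => by
      have h1 : φ y.fst ≤ φ q₀ := ((mem_minimizers_iff h₀).1 hy.1).2
      have h2 : energy φ M y = φ y.fst := by simp [energy, hy.2]
      have h3 : 0 < min m 1 := lt_min hm one_pos
      rw [mem_ofPred_eq, h2]
      linarith
  refine ⟨δ, hδ, fun I x hx h0 t ht => (hmε _ ?_ ?_).le⟩
  all_goals
    have h1 : energy φ M (x 0) < φ q₀ + min m 1 := hsub (by
      rw [Metric.mem_cthickening_iff, ← ENNReal.ofReal_toReal (Metric.infEDist_ne_top hne)]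
      exact ENNReal.ofReal_le_ofReal h0)
    have h2 := energy_le hφ hKmin hK hc hM hMc hML hx le_rfl (hx.nonneg t ht) ht
  · exact ⟨hx.mem t ht, by linarith [min_le_right m 1]⟩
  · linarith [min_le_left m 1]

end HiHBM

theorem theorem1 {n : ℕ} (G : SimpleGraph (Fin n)) [DecidableRel G.Adj] (hG : G.Connected)
    (φ : EuclideanSpace ℝ (Fin n) → ℝ) (L : NNReal) (d Kmin Kmax : ℝ)
    (hφ_smooth : ContDiff ℝ 1 φ)
    (hφ_compact : ∀ c : ℝ, IsCompact {q | φ q ≤ c})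
    (hφ_lip : LipschitzWith L (∇ φ))
    (hφ_convex : ConvexOn ℝ Set.univ φ)
    (hKmin : 0 < Kmin) (hK : Kmin ≤ Kmax) :
    DiffIncl.IsGAS (HiHBM.flowMap G φ Kmin Kmax) (HiHBM.flowSet n d) (HiHBM.target φ d) := by
  have hn : n ≠ 0 := by
    obtain ⟨i⟩ := hG.nonempty
    exact (Fin.pos i).ne'
  obtain ⟨q₀, h₀⟩ := HiHBM.minimizers_nonempty (d := d) hn hφ_smooth.continuous hφ_compact
  exact
    { nonempty := ⟨WithLp.toLp 2 (q₀, 0), h₀, rfl⟩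
      isCompact := HiHBM.isCompact_target hn hφ_smooth.continuous hφ_compact
      stable := HiHBM.isStable hG hφ_smooth hφ_compact hKmin hK
      -- Convergence holds from every initial condition, so any radius would do.
      attractive := ⟨1, one_pos, fun _ _ hx _ => HiHBM.boundedAndConverges hG hφ_smooth hφ_compact
        hφ_lip hφ_convex hKmin hK hx⟩
      basin_eq := eq_univ_of_forall fun _ _ _ hx _ => HiHBM.boundedAndConverges hG hφ_smooth
        hφ_compact hφ_lip hφ_convex hKmin hK hx }
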